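/- Model. Let $\mathbf P=(P_{ij})_{i,j\in[n]}$ be a parameter matrix, i.e. a symmetric matrix with zero diagonal and entries in $[0,1]$. The random graph $G\sim\mathrm{RG}(n,\mathbf P)$ on the vertex set $[n]$ has each edge $\{i,j\}$, $i<j$, independently with probability $P_{ij}$. Let $s\in(0,1]$. Given $G$, the graphs $G_1',\dots,G_m'$ are obtained from $G$ by keeping each edge of $G$ independently with probability $s$, independently for each of the $m$ graphs. The nodes of $G_k'$ are then relabeled by a permutation $\pi_k$ of $[n]$, which gives $G_k$: $\{\pi_k(i),\pi_k(j)\}$ is an edge of $G_k$ if and only if $\{i,j\}$ is an edge of $G_k'$. Here $\pi_1=\mathrm{id}$ (so $G_1=G_1'$ is the reference graph) and $\pi_2,\dots,\pi_m$ are independent uniformly random permutations, independent of the graphs. An estimator maps $(G_1,\dots,G_m)$ to a tuple $(\mu_{12},\dots,\mu_{1m})$ of injective partial functions from $[n]$ to $[n]$; it matches the graphs exactly if $\mu_{1k}=\pi^*_{1k}:=\pi_k\circ\pi_1^{-1}$ for all $2\le k\le m$. Theorem. Fix an integer $m\ge 1$, $\varepsilon>0$ and $s\in(0,1]$, and let $d=d(n)$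 be real numbers with $d(n)\,s\ge(1+\varepsilon)\log n$ for all $n\ge 1$. Then there exist, for each $n\ge1$, a (deterministic) parameter matrix $P=P^{(n)}$ with $$d_i:=\sum_{j\ne i}P_{ij}\le d(n)\quad\text{for all } i\in[n],\qquad p_{\max}:=\max_{i,j}P_{ij}=\frac{\log^2 n}{n},$$ and an estimator that has access to $P$ (it may depend on $P$), such that for $G\sim\mathrm{RG}(n,P)$ the $m$ graphs $G_1,\dots,G_m$ are exactly matched with probability $1-o(1)$ as $n\to\infty$. Moreover, with the same $P$ and the same estimator, the graphs are also exactly matched with probability $1-o(1)$ when the nodes of the reference graph $G_1$ are relabeled as well, i.e. when $\pi_1,\dots,\pi_m$ are all independent and uniformly random. -/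

import Mathlib

/-- `P` is the parameter matrix of an inhomogeneous random graph on `n` nodes: a symmetric matrix
with zero diagonal and entries in `[0, 1]`. -/
structure IsParameterMatrix {n : ℕ} (P : Matrix (Fin n) (Fin n) ℝ) : Prop where
  symm : P.IsSymm
  diag : ∀ i, P i i = 0
  nonneg : ∀ i j, 0 ≤ P i j
  le_one : ∀ i j, P i j ≤ 1

/-- The expected degree `d_i = ∑_{j ≠ i} P_{ij}` of the node `i`. -/
def expectedDegree {n : ℕ} (P : Matrix (Fin n) (Fin n) ℝ) (i : Fin n) : ℝ :=
  ∑ j ∈ Finset.univ.erase i, P i j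

open Classical in
/-- The probability that the inhomogeneous random graph `RG(n, P)`, in which the edges `{i, j}`,
`i < j`, are present independently with probabilities `P i j`, is equal to `H`. -/
noncomputable def rgProb {n : ℕ} (P : Matrix (Fin n) (Fin n) ℝ) (H : SimpleGraph (Fin n)) : ℝ :=
  ∏ i : Fin n, ∏ j ∈ Finset.Ioi i, if H.Adj i j then P i j else 1 - P i j

open Classical in
/-- The probability that keeping every edge of the parent graph `G` independently with
probability `s` (and adding no edges) yields the graph `H`. -/
noncomputable def subsampleProb {n : ℕ} (s : ℝ) (G H : SimpleGraph (Fin n)) : ℝ :=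
  rgProb (Matrix.of fun i j => if G.Adj i j then s else 0) H

/-- A tuple of node relabelings, one for each of the `m` graphs. The index `0` stands for the
reference graph, the first of the `m` graphs. -/
abbrev Labeling (m n : ℕ) : Type := Fin m → Equiv.Perm (Fin n)

open Classical in
/-- The relabelings that leave the reference graph as it is. -/
noncomputable def referenceLabelings (m n : ℕ) [NeZero m] : Finset (Labeling m n) :=
  Finset.univ.filter fun π => π 0 = 1

/-- The observed graphs: `{i, j}` is an edge of the `k`-th sibling graph `G' k` if and only if
`{π k i, π k j}` is an edge of the `k`-th observed graph. -/
def observed {m n : ℕ} (π : Labeling m n) (G' : Fin m → SimpleGraph (Fin n)) :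
    Fin m → SimpleGraph (Fin n) :=
  fun k => (G' k).comap (π k).symm

/-- A matching: for each graph but the reference graph, an injective partial function from the
nodes of the reference graph to the nodes of that graph. -/
abbrev Matching (m n : ℕ) [NeZero m] : Type := {k : Fin m // k ≠ 0} → (Fin n ≃. Fin n)

/-- The true matching: the node correspondence `π k ∘ (π 0)⁻¹` between the reference graph and the
`k`-th graph. It is `π k` if the reference graph is not relabeled. -/
def trueMatching {m n : ℕ} [NeZero m] (π : Labeling m n) : Matching m n :=
  fun k => ((π 0).symm.trans (π k)).toPEquiv

/-- An estimator maps the `m` observed graphs on `n` nodes to a matching. -/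
abbrev Estimator (m n : ℕ) [NeZero m] : Type := (Fin m → SimpleGraph (Fin n)) → Matching m n

open Classical in
/-- The probability that the estimator `A` exactly matches the `m` observed graphs, where the
parent graph is drawn from `RG(n, P)`, the `m` sibling graphs are obtained from it by independent
subsampling with probability `s`, and the siblings are relabeled by a tuple of permutations that is
drawn uniformly from `L`, independently of the graphs. -/
noncomputable def exactMatchProb {m n : ℕ} [NeZero m] (P : Matrix (Fin n) (Fin n) ℝ) (s : ℝ)
    (L : Finset (Labeling m n)) (A : Estimator m n) : ℝ :=
  ∑ π ∈ L, ∑ G : SimpleGraph (Fin n), ∑ G' : Fin m → SimpleGraph (Fin n),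
    if A (observed π G') = trueMatching π then
      (L.card : ℝ)⁻¹ * (rgProb P G * ∏ k, subsampleProb s G (G' k))
    else 0

/-!
The matrix `P` is `log² n / n` times the adjacency matrix of a graph `H` of density
`ρ = (1 + ε / 2) / (s log n)`, and the estimator aligns every observed graph separately with `H`:
it looks for a relabeling that makes the observed graph a subgraph of `H`. The composition of two
such alignments is the true matching as soon as each sibling graph `g` is *rigid* (`IsRigid`), that
is, the identity is its only relabeling that is a subgraph of `H`. Nothing distinguishes the
reference graph here, so both laws of the relabelings are covered (`le_exactMatchProb`).

A suitable `H` is found by the probabilistic method. If `H` is an Erdős–Rényi graph with edge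
probability `ρ`, then all its degrees are at most `(1 + ε) n / (s log n)` with high probability,
which bounds the expected degrees by `(1 + ε) log n / s ≤ d n`. The graph `g` is obtained from `H`
by keeping every edge with probability `q = s log² n / n`, so it is an Erdős–Rényi graph with mean
degree about `(1 + ε / 2) log n`. As `1 + ε / 2 > 1`, all its degrees are at least `c log n` with
high probability, for some `c > 0`. Hence a permutation `σ` that moves `t` nodes moves at least
about `(c / 2) t log n` edges of `g`, and each of them is mapped to an edge of `H` with probability
about `ρ`, which is of order `1 / log n`. As `t log n log log n` exceeds every multiple of
`t log n`, this beats the number `n ^ t` of such permutations, uniformly in `t`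
(`jointExp_nonrigid_le`).

The dependence between an edge and its image is removed by a coloring of the potential edges with
three colors in which no moved edge has the color of its image (`exists_three_coloring`): within one
color, the events are independent, and an exponential moment can be computed
(`jointExp_prod_image`).
-/

open Filter Topology

/-! ### Random graphs as products over potential edges -/

/-- The potential edges of a graph on `n` nodes. -/
abbrev Edge (n : ℕ) : Type := {e : Sym2 (Fin n) // ¬ e.IsDiag}

/-- The matrix with entry `a` at the edges of `G` and entry `0` elsewhere. -/
noncomputable def scaledAdj {n : ℕ} (a : ℝ) (G : SimpleGraph (Fin n)) :
    Matrix (Fin n) (Fin n) ℝ :=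
  open Classical in Matrix.of fun i j => if G.Adj i j then a else 0

/-- A graph is the same thing as a choice of a truth value for every potential edge. -/
def graphEquiv (n : ℕ) : SimpleGraph (Fin n) ≃ (Edge n → Prop) where
  toFun H e := e.1 ∈ H.edgeSet
  invFun f := SimpleGraph.fromEdgeSet {e | ∃ h, f ⟨e, h⟩}
  left_inv H := by
    ext u v
    simp only [SimpleGraph.fromEdgeSet_adj, Set.mem_ofPred_eq, SimpleGraph.mem_edgeSet]
    constructor
    · rintro ⟨⟨_, h⟩, _⟩
      exact h
    · intro h
      exact ⟨⟨by simpa using h.ne, h⟩, h.ne⟩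
  right_inv f := by
    funext e
    have := e.2
    simp [SimpleGraph.edgeSet_fromEdgeSet, this]

open Classical in
/-- Summing a product of edge factors over all graphs: the edges are independent. -/
lemma sum_graph_prod {n : ℕ} (F : Edge n → Prop → ℝ) :
    ∑ H : SimpleGraph (Fin n), ∏ e : Edge n, F e (e.1 ∈ H.edgeSet) =
      ∏ e : Edge n, (F e True + F e False) := by
  have h1 : ∀ e : Edge n, F e True + F e False = ∑ p : Prop, F e p := by
    intro e
    rw [Fintype.univ_Prop, Finset.sum_insert (by simp), Finset.sum_singleton]
  simp_rw [h1]
  rw [Finset.prod_univ_sum, Fintype.piFinset_univ]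
  exact Fintype.sum_equiv (graphEquiv n) _ _ (fun H => rfl)

open Classical in
lemma prod_edge_eq {n : ℕ} (f : Sym2 (Fin n) → ℝ) :
    ∏ i : Fin n, ∏ j ∈ Finset.Ioi i, f s(i, j) = ∏ e : Edge n, f e.1 := by
  rw [Finset.prod_sigma']
  refine Finset.prod_bij (fun x hx => ⟨s(x.1, x.2), ?_⟩) ?_ ?_ ?_ ?_
  · have : x.1 < x.2 := by simpa using hx
    simpa using this.ne
  · intros; simp
  · rintro ⟨a, b⟩ h ⟨c, d⟩ h' heq
    simp only [Finset.mem_sigma, Finset.mem_univ, Finset.mem_Ioi, true_and] at h h'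
    simp only [Subtype.mk.injEq, Sym2.eq_iff] at heq
    rcases heq with ⟨rfl, rfl⟩ | ⟨rfl, rfl⟩
    · rfl
    · exact absurd h h'.asymm
  · rintro ⟨e, he⟩ _
    induction e with
    | _ a b =>
      simp only [Sym2.mk_isDiag_iff] at he
      rcases lt_or_gt_of_ne he with h | h
      · exact ⟨⟨a, b⟩, by simpa using h, rfl⟩
      · exact ⟨⟨b, a⟩, by simpa using h, Subtype.ext Sym2.eq_swap⟩
  · intros; rfl

open Classical in
/-- The factor that the edge `e` contributes to the probability of a graph, if its own probability
is `a` on the edges of `G` and `0` elsewhere. -/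
noncomputable def edgeFactor {n : ℕ} (a : ℝ) (G : SimpleGraph (Fin n)) (e : Edge n) (p : Prop) :
    ℝ :=
  if p then (if e.1 ∈ G.edgeSet then a else 0) else 1 - (if e.1 ∈ G.edgeSet then a else 0)

open Classical in
lemma rgProb_scaledAdj {n : ℕ} (a : ℝ) (G H : SimpleGraph (Fin n)) :
    rgProb (scaledAdj a G) H = ∏ e : Edge n, edgeFactor a G e (e.1 ∈ H.edgeSet) := by
  classical
  have := prod_edge_eq (n := n) (fun e => if e ∈ H.edgeSet then (if e ∈ G.edgeSet then a else 0)
    else 1 - (if e ∈ G.edgeSet then a else 0))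
  simp only [SimpleGraph.mem_edgeSet] at this
  simp only [edgeFactor, rgProb, scaledAdj, Matrix.of_apply]
  convert this

lemma subsampleProb_eq {n : ℕ} (s : ℝ) (G H : SimpleGraph (Fin n)) :
    subsampleProb s G H = rgProb (scaledAdj s G) H := rfl

lemma edgeFactor_add {n : ℕ} (a : ℝ) (G : SimpleGraph (Fin n)) (e : Edge n) :
    edgeFactor a G e True + edgeFactor a G e False = 1 := by
  simp [edgeFactor]

lemma edgeFactor_nonneg {n : ℕ} {a : ℝ} (h0 : 0 ≤ a) (h1 : a ≤ 1) (G : SimpleGraph (Fin n))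
    (e : Edge n) (p : Prop) : 0 ≤ edgeFactor a G e p := by
  unfold edgeFactor
  split_ifs <;> linarith

lemma rgProb_scaledAdj_nonneg {n : ℕ} {a : ℝ} (h0 : 0 ≤ a) (h1 : a ≤ 1)
    (G H : SimpleGraph (Fin n)) : 0 ≤ rgProb (scaledAdj a G) H := by
  rw [rgProb_scaledAdj]
  exact Finset.prod_nonneg fun e _ => edgeFactor_nonneg h0 h1 G e _

open Classical in
lemma sum_rgProb_scaledAdj {n : ℕ} (a : ℝ) (G : SimpleGraph (Fin n)) :
    ∑ H, rgProb (scaledAdj a G) H = 1 := by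
  simp_rw [rgProb_scaledAdj]
  rw [sum_graph_prod (edgeFactor a G)]
  exact Finset.prod_eq_one fun e _ => edgeFactor_add a G e

/-- The random graph has no edges outside of the support of its parameter matrix. -/
lemma rgProb_scaledAdj_eq_zero {n : ℕ} (a : ℝ) {G H : SimpleGraph (Fin n)} (h : ¬ H ≤ G) :
    rgProb (scaledAdj a G) H = 0 := by
  rw [rgProb_scaledAdj]
  obtain ⟨u, v, huv, hn⟩ : ∃ u v, H.Adj u v ∧ ¬ G.Adj u v := by
    simpa only [SimpleGraph.le_iff_adj, not_forall, exists_prop] using h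
  refine Finset.prod_eq_zero (Finset.mem_univ (⟨s(u, v), by simpa using huv.ne⟩ : Edge n)) ?_
  simp [edgeFactor, huv, hn]

open Classical in
/-- Subsampling the random graph `RG(n, P)` yields the random graph `RG(n, s P)`. -/
lemma sum_rgProb_mul_subsampleProb {n : ℕ} (p s : ℝ) (H g : SimpleGraph (Fin n)) :
    ∑ G, rgProb (scaledAdj p H) G * subsampleProb s G g = rgProb (scaledAdj (s * p) H) g := by
  simp_rw [subsampleProb_eq, rgProb_scaledAdj, ← Finset.prod_mul_distrib]
  have := sum_graph_prod (n := n) (fun e P => edgeFactor p H e P *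
    (if e.1 ∈ g.edgeSet then (if P then s else 0) else 1 - (if P then s else 0)))
  simp only [edgeFactor] at this ⊢
  convert this using 1
  · exact Finset.sum_congr rfl fun G _ => Finset.prod_congr rfl fun e _ => by congr!
  refine Finset.prod_congr rfl fun e _ => ?_
  by_cases h1 : e.1 ∈ H.edgeSet <;> by_cases h2 : e.1 ∈ g.edgeSet <;> simp [h1, h2] <;> ring

/-! ### Reduction to the rigidity of a sibling graph -/

/-- The identity is the only relabeling of `g` that makes it a subgraph of `H`. -/
def IsRigid {n : ℕ} (H g : SimpleGraph (Fin n)) : Prop :=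
  ∀ σ : Equiv.Perm (Fin n), g ≤ H.comap σ → σ = 1

open Classical in
/-- The relabeling that makes the graph `g` a subgraph of `H`; the identity if there is none. -/
noncomputable def align {n : ℕ} (H g : SimpleGraph (Fin n)) : Equiv.Perm (Fin n) :=
  if h : ∃ σ : Equiv.Perm (Fin n), g ≤ H.comap σ then h.choose else 1

lemma align_comap {n : ℕ} {H g : SimpleGraph (Fin n)} (hg : g ≤ H) (hr : IsRigid H g)
    (π : Equiv.Perm (Fin n)) : align H (g.comap π.symm) = π.symm := by
  have hex : ∃ σ : Equiv.Perm (Fin n), g.comap π.symm ≤ H.comap σ :=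
    ⟨π.symm, fun _ _ h => hg h⟩
  have hs := hex.choose_spec
  rw [align, dif_pos hex]
  generalize hex.choose = σ at hs
  have : σ * π = 1 := by
    apply hr
    intro u v huv
    have := @hs (π u) (π v) (by simpa using huv)
    simpa using this
  have := eq_inv_of_mul_eq_one_left this
  exact this

/-- The estimator that aligns every observed graph, separately, with the support `H` of the
parameter matrix. -/
noncomputable def alignEstimator (m : ℕ) {n : ℕ} [NeZero m] (H : SimpleGraph (Fin n)) :
    Estimator m n :=
  fun g k => ((align H (g 0)).trans (align H (g k)).symm).toPEquiv

lemma alignEstimator_observed {m n : ℕ} [NeZero m] {H : SimpleGraph (Fin n)}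
    {G' : Fin m → SimpleGraph (Fin n)} (h : ∀ k, G' k ≤ H ∧ IsRigid H (G' k))
    (π : Labeling m n) : alignEstimator m H (observed π G') = trueMatching π := by
  funext k
  simp only [alignEstimator, observed, trueMatching, align_comap (h _).1 (h _).2, Equiv.symm_symm]

open Classical in
/-- The probability that a sibling graph, whose edges are drawn with probability `q` from the edges
of `H`, can be relabeled nontrivially to a subgraph of `H`. -/
noncomputable def nonrigidProb {n : ℕ} (q : ℝ) (H : SimpleGraph (Fin n)) : ℝ :=
  ∑ g, rgProb (scaledAdj q H) g * if IsRigid H g then 0 else 1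

open Classical in
lemma sum_prod_subsample {m n : ℕ} (s : ℝ) (G : SimpleGraph (Fin n))
    (φ : Fin m → SimpleGraph (Fin n) → ℝ) :
    ∑ G' : Fin m → SimpleGraph (Fin n), ∏ k, (subsampleProb s G (G' k) * φ k (G' k)) =
      ∏ k, ∑ g, subsampleProb s G g * φ k g := by
  rw [Finset.prod_univ_sum, Fintype.piFinset_univ]

open Classical in
lemma sum_all_eq_one {m n : ℕ} (p s : ℝ) (H : SimpleGraph (Fin n)) :
    ∑ G, ∑ G' : Fin m → SimpleGraph (Fin n),
      rgProb (scaledAdj p H) G * ∏ k, subsampleProb s G (G' k) = 1 := by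
  rw [← sum_rgProb_scaledAdj p H]
  refine Finset.sum_congr rfl fun G _ => ?_
  rw [← Finset.mul_sum]
  have := sum_prod_subsample (m := m) s G (fun _ _ => 1)
  simp only [mul_one] at this
  rw [this]
  simp [subsampleProb_eq, sum_rgProb_scaledAdj]

open Classical in
/-- The marginal law of one of the sibling graphs. -/
lemma sum_marginal {m n : ℕ} (p s : ℝ) (H : SimpleGraph (Fin n)) (k : Fin m)
    (φ : SimpleGraph (Fin n) → ℝ) :
    ∑ G, ∑ G' : Fin m → SimpleGraph (Fin n),
      rgProb (scaledAdj p H) G * (∏ k, subsampleProb s G (G' k)) * φ (G' k) =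
      ∑ g, rgProb (scaledAdj (s * p) H) g * φ g := by
  have h1 : ∀ G, ∑ G' : Fin m → SimpleGraph (Fin n),
      rgProb (scaledAdj p H) G * (∏ k, subsampleProb s G (G' k)) * φ (G' k) =
      rgProb (scaledAdj p H) G * ∑ g, subsampleProb s G g * φ g := by
    intro G
    have := sum_prod_subsample (m := m) s G (fun l g => if l = k then φ g else 1)
    simp only [mul_assoc, ← Finset.mul_sum]
    congr 1
    convert this using 1
    · refine Finset.sum_congr rfl fun G' _ => ?_
      rw [Finset.prod_mul_distrib]
      simp
    · rw [Finset.prod_eq_single k]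
      · simp
      · intro l _ hl
        simp [hl, subsampleProb_eq, sum_rgProb_scaledAdj]
      · simp
  simp_rw [h1, Finset.mul_sum]
  rw [Finset.sum_comm]
  refine Finset.sum_congr rfl fun g _ => ?_
  rw [← sum_rgProb_mul_subsampleProb, Finset.sum_mul]
  exact Finset.sum_congr rfl fun G _ => by ring

lemma exactMatchProb_le_one {m n : ℕ} [NeZero m] {p s : ℝ} (hp0 : 0 ≤ p) (hp1 : p ≤ 1)
    (hs0 : 0 ≤ s) (hs1 : s ≤ 1) (H : SimpleGraph (Fin n)) {L : Finset (Labeling m n)}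
    (hL : L.Nonempty) (A : Estimator m n) : exactMatchProb (scaledAdj p H) s L A ≤ 1 := by
  classical
  have hc : (L.card : ℝ) ≠ 0 := by exact_mod_cast hL.card_ne_zero
  calc exactMatchProb (scaledAdj p H) s L A
      ≤ ∑ π ∈ L, ∑ G : SimpleGraph (Fin n), ∑ G' : Fin m → SimpleGraph (Fin n),
        (L.card : ℝ)⁻¹ * (rgProb (scaledAdj p H) G * ∏ k, subsampleProb s G (G' k)) := by
        unfold exactMatchProb
        refine Finset.sum_le_sum fun π _ => Finset.sum_le_sum fun G _ =>
          Finset.sum_le_sum fun G' _ => ?_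
        split_ifs
        · exact le_rfl
        · have := rgProb_scaledAdj_nonneg hp0 hp1 H G
          have h2 : 0 ≤ ∏ k, subsampleProb s G (G' k) :=
            Finset.prod_nonneg fun k _ => rgProb_scaledAdj_nonneg hs0 hs1 G (G' k)
          positivity
    _ = 1 := by
        simp_rw [← Finset.mul_sum]
        simp_rw [Finset.mul_sum (s := (Finset.univ : Finset (Fin m → SimpleGraph (Fin n))))]
        rw [Finset.sum_const, sum_all_eq_one]
        simp [hc]

/-- The alignment estimator fails only if one of the sibling graphs is not rigid. -/
lemma le_exactMatchProb {m n : ℕ} [NeZero m] {p s : ℝ} (hp0 : 0 ≤ p) (hp1 : p ≤ 1)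
    (hs0 : 0 ≤ s) (hs1 : s ≤ 1) (H : SimpleGraph (Fin n)) {L : Finset (Labeling m n)}
    (hL : L.Nonempty) :
    1 - m * nonrigidProb (s * p) H ≤
      exactMatchProb (scaledAdj p H) s L (alignEstimator m H) := by
  classical
  have hc : (L.card : ℝ) ≠ 0 := by exact_mod_cast hL.card_ne_zero
  let bad : SimpleGraph (Fin n) → ℝ := fun g => if g ≤ H ∧ IsRigid H g then 0 else 1
  have hbad : ∀ g, 0 ≤ bad g := fun g => by simp only [bad]; split_ifs <;> norm_num
  have hbadsum : ∑ g, rgProb (scaledAdj (s * p) H) g * bad g = nonrigidProb (s * p) H := by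
    refine Finset.sum_congr rfl fun g _ => ?_
    by_cases hg : g ≤ H
    · simp [bad, hg]
    · simp [rgProb_scaledAdj_eq_zero _ hg]
  calc 1 - m * nonrigidProb (s * p) H
      = ∑ π ∈ L, (L.card : ℝ)⁻¹ * ∑ G, ∑ G' : Fin m → SimpleGraph (Fin n),
        (rgProb (scaledAdj p H) G * (∏ k, subsampleProb s G (G' k)) * (1 - ∑ k, bad (G' k))) := by
        rw [Finset.sum_const, nsmul_eq_mul, ← mul_assoc, mul_inv_cancel₀ hc, one_mul]
        simp_rw [mul_sub, mul_one, Finset.sum_sub_distrib, Finset.mul_sum]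
        rw [sum_all_eq_one]
        congr 1
        have : ∀ G : SimpleGraph (Fin n), ∑ G' : Fin m → SimpleGraph (Fin n), ∑ k : Fin m,
            rgProb (scaledAdj p H) G * (∏ k, subsampleProb s G (G' k)) * bad (G' k) =
            ∑ k : Fin m, ∑ G' : Fin m → SimpleGraph (Fin n),
            rgProb (scaledAdj p H) G * (∏ k, subsampleProb s G (G' k)) * bad (G' k) :=
          fun G => Finset.sum_comm
        simp_rw [this]
        rw [Finset.sum_comm]
        simp_rw [sum_marginal, hbadsum]
        simp
    _ ≤ exactMatchProb (scaledAdj p H) s L (alignEstimator m H) := by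
        unfold exactMatchProb
        simp_rw [Finset.mul_sum]
        refine Finset.sum_le_sum fun π _ => Finset.sum_le_sum fun G _ =>
          Finset.sum_le_sum fun G' _ => ?_
        have h1 := rgProb_scaledAdj_nonneg hp0 hp1 H G
        have h2 : 0 ≤ ∏ k, subsampleProb s G (G' k) :=
          Finset.prod_nonneg fun k _ => rgProb_scaledAdj_nonneg hs0 hs1 G (G' k)
        have h3 : 0 ≤ ∑ k, bad (G' k) := Finset.sum_nonneg fun k _ => hbad _
        have hci : (0 : ℝ) ≤ (L.card : ℝ)⁻¹ := by positivity
        split_ifs with h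
        · refine mul_le_mul_of_nonneg_left ?_ hci
          exact mul_le_of_le_one_right (mul_nonneg h1 h2) (by linarith)
        · have : ∃ k, ¬ (G' k ≤ H ∧ IsRigid H (G' k)) := by
            by_contra! hcon
            exact h (alignEstimator_observed hcon π)
          obtain ⟨k, hk⟩ := this
          have h4 : 1 ≤ ∑ k, bad (G' k) := by
            have := Finset.single_le_sum (f := fun k => bad (G' k)) (fun k _ => hbad _)
              (Finset.mem_univ k)
            simpa [bad, hk] using this
          exact mul_nonpos_of_nonneg_of_nonpos hci
            (mul_nonpos_of_nonneg_of_nonpos (mul_nonneg h1 h2) (by linarith))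

/-! ### Independent edges -/

open Classical in
/-- The expectation of `Φ H g`, where `H` is an Erdős–Rényi graph with edge probability `ρ`, and `g`
is obtained from `H` by keeping every edge with probability `q`. -/
noncomputable def jointExp {n : ℕ} (ρ q : ℝ) (Φ : SimpleGraph (Fin n) → SimpleGraph (Fin n) → ℝ) :
    ℝ :=
  ∑ H, ∑ g, rgProb (scaledAdj ρ ⊤) H * rgProb (scaledAdj q H) g * Φ H g

lemma jointExp_mono {n : ℕ} {ρ q : ℝ} (hρ0 : 0 ≤ ρ) (hρ1 : ρ ≤ 1) (hq0 : 0 ≤ q) (hq1 : q ≤ 1)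
    {Φ Ψ : SimpleGraph (Fin n) → SimpleGraph (Fin n) → ℝ} (h : ∀ H g, Φ H g ≤ Ψ H g) :
    jointExp ρ q Φ ≤ jointExp ρ q Ψ :=
  Finset.sum_le_sum fun H _ => Finset.sum_le_sum fun g _ => mul_le_mul_of_nonneg_left (h H g)
    (mul_nonneg (rgProb_scaledAdj_nonneg hρ0 hρ1 _ _) (rgProb_scaledAdj_nonneg hq0 hq1 _ _))

lemma jointExp_add {n : ℕ} (ρ q : ℝ) (Φ Ψ : SimpleGraph (Fin n) → SimpleGraph (Fin n) → ℝ) :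
    jointExp ρ q (fun H g => Φ H g + Ψ H g) = jointExp ρ q Φ + jointExp ρ q Ψ := by
  simp only [jointExp, mul_add, Finset.sum_add_distrib]

lemma jointExp_mul {n : ℕ} (ρ q a : ℝ) (Φ : SimpleGraph (Fin n) → SimpleGraph (Fin n) → ℝ) :
    jointExp ρ q (fun H g => a * Φ H g) = a * jointExp ρ q Φ := by
  simp only [jointExp, Finset.mul_sum]
  exact Finset.sum_congr rfl fun H _ => Finset.sum_congr rfl fun g _ => by ring

lemma jointExp_sum {n : ℕ} {ι : Type*} (ρ q : ℝ) (s : Finset ι)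
    (Φ : ι → SimpleGraph (Fin n) → SimpleGraph (Fin n) → ℝ) :
    jointExp ρ q (fun H g => ∑ i ∈ s, Φ i H g) = ∑ i ∈ s, jointExp ρ q (Φ i) := by
  classical
  induction s using Finset.induction_on with
  | empty => simp [jointExp]
  | insert a s ha ih => simp only [Finset.sum_insert ha, jointExp_add, ih]

open Classical in
/-- A product of edge factors has a product as its expectation. -/
lemma jointExp_prod {n : ℕ} (ρ q : ℝ) (ψ : Edge n → Prop → Prop → ℝ) :
    jointExp ρ q (fun H g => ∏ e : Edge n, ψ e (e.1 ∈ H.edgeSet) (e.1 ∈ g.edgeSet)) =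
      ∏ e : Edge n, (ρ * q * ψ e True True + ρ * (1 - q) * ψ e True False +
        (1 - ρ) * ψ e False False) := by
  classical
  have h1 : ∀ H : SimpleGraph (Fin n),
      ∑ g, rgProb (scaledAdj ρ ⊤) H * rgProb (scaledAdj q H) g *
        ∏ e : Edge n, ψ e (e.1 ∈ H.edgeSet) (e.1 ∈ g.edgeSet) =
      ∏ e : Edge n, (fun e P => edgeFactor ρ ⊤ e P *
        ((if P then q else 0) * ψ e P True + (1 - if P then q else 0) * ψ e P False))
        e (e.1 ∈ H.edgeSet) := by
    intro H
    simp_rw [mul_assoc]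
    rw [← Finset.mul_sum, rgProb_scaledAdj, Finset.prod_mul_distrib]
    congr 1
    simp_rw [rgProb_scaledAdj, ← Finset.prod_mul_distrib]
    rw [sum_graph_prod (fun e P => edgeFactor q H e P * ψ e (e.1 ∈ H.edgeSet) P)]
    refine Finset.prod_congr rfl fun e _ => ?_
    simp only [edgeFactor]
    congr! 1 <;> congr! 1 <;> simp
  unfold jointExp
  rw [Finset.sum_congr rfl fun H _ => h1 H, sum_graph_prod (fun e P => edgeFactor ρ ⊤ e P *
    ((if P then q else 0) * ψ e P True + (1 - if P then q else 0) * ψ e P False))]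
  refine Finset.prod_congr rfl fun e _ => ?_
  have := e.2
  simp [edgeFactor, this]
  ring

lemma jointExp_left {n : ℕ} (ρ q : ℝ) (Φ : SimpleGraph (Fin n) → ℝ) :
    jointExp ρ q (fun H _ => Φ H) = ∑ H, rgProb (scaledAdj ρ ⊤) H * Φ H := by
  classical
  unfold jointExp
  refine Finset.sum_congr rfl fun H _ => ?_
  rw [← Finset.sum_mul, ← Finset.mul_sum, sum_rgProb_scaledAdj, mul_one]

/-! ### Degrees -/

open Classical in
/-- The degree of the node `v`, as a number of potential edges. -/
noncomputable def edgeDeg {n : ℕ} (g : SimpleGraph (Fin n)) (v : Fin n) : ℕ :=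
  (Finset.univ.filter fun e : Edge n => v ∈ e.1 ∧ e.1 ∈ g.edgeSet).card

open Classical in
lemma sum_star {n : ℕ} (v : Fin n) (F : Sym2 (Fin n) → ℝ) :
    ∑ e : Edge n with v ∈ e.1, F e.1 = ∑ w ∈ Finset.univ.erase v, F s(v, w) := by
  symm
  refine Finset.sum_bij (fun w hw => ⟨s(v, w), ?_⟩) ?_ ?_ ?_ ?_
  · simpa using (Finset.ne_of_mem_erase hw).symm
  · intros; simp
  · intro a _ b _ h
    exact Sym2.congr_right.1 (Subtype.ext_iff.1 h)
  · rintro ⟨e, he⟩ hv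
    have hv' : v ∈ e := by simpa using hv
    obtain ⟨w, rfl⟩ := hv'
    refine ⟨w, ?_, rfl⟩
    have : v ≠ w := by simpa using he
    simp [this.symm]
  · intros; rfl

open Classical in
lemma card_star {n : ℕ} (v : Fin n) :
    (Finset.univ.filter fun e : Edge n => v ∈ e.1).card = n - 1 := by
  have := sum_star v (fun _ => 1)
  simp only [Finset.sum_const, nsmul_eq_mul, mul_one, Nat.cast_inj] at this
  rw [this, Finset.card_erase_of_mem (Finset.mem_univ v)]
  simp

open Classical in
lemma expectedDegree_scaledAdj {n : ℕ} (p : ℝ) (H : SimpleGraph (Fin n)) (v : Fin n) :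
    expectedDegree (scaledAdj p H) v = edgeDeg H v * p := by
  have := sum_star v (fun e => if e ∈ H.edgeSet then p else 0)
  simp only [SimpleGraph.mem_edgeSet] at this
  simp only [expectedDegree, scaledAdj, Matrix.of_apply]
  convert this.symm
  rw [← Finset.sum_filter, Finset.sum_const, nsmul_eq_mul, Finset.filter_filter]
  rfl

open Classical in
lemma prod_star {n : ℕ} (g : SimpleGraph (Fin n)) (v : Fin n) (x : ℝ) :
    ∏ e : Edge n, (if v ∈ e.1 ∧ e.1 ∈ g.edgeSet then x else 1) = x ^ edgeDeg g v := by
  rw [← Finset.prod_filter, Finset.prod_const, edgeDeg]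

open Classical in
/-- The moment generating function of the degrees of `H`. -/
lemma jointExp_pow_edgeDeg_left {n : ℕ} (ρ q y : ℝ) (v : Fin n) :
    jointExp ρ q (fun H _ => y ^ edgeDeg H v) = (1 + ρ * (y - 1)) ^ (n - 1) := by
  classical
  simp_rw [← prod_star]
  have := jointExp_prod (n := n) ρ q (fun e P _ => if v ∈ e.1 ∧ P then y else 1)
  refine Eq.trans (by congr!) (this.trans ?_)
  rw [← card_star v, ← Finset.prod_const, Finset.prod_filter]
  refine Finset.prod_congr rfl fun e _ => ?_
  by_cases h : v ∈ e.1 <;> simp [h] <;> ring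

open Classical in
/-- The moment generating function of the degrees of `g`. -/
lemma jointExp_pow_edgeDeg_right {n : ℕ} (ρ q x : ℝ) (v : Fin n) :
    jointExp ρ q (fun _ g => x ^ edgeDeg g v) = (1 - ρ * q * (1 - x)) ^ (n - 1) := by
  classical
  simp_rw [← prod_star]
  have := jointExp_prod (n := n) ρ q (fun e _ Q => if v ∈ e.1 ∧ Q then x else 1)
  refine Eq.trans (by congr!) (this.trans ?_)
  rw [← card_star v, ← Finset.prod_const, Finset.prod_filter]
  refine Finset.prod_congr rfl fun e _ => ?_
  by_cases h : v ∈ e.1 <;> simp [h] <;> ring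

/-! ### The action of relabelings on potential edges -/

/-- The permutation of the potential edges that is induced by a permutation of the nodes. -/
def edgePerm {n : ℕ} (σ : Equiv.Perm (Fin n)) : Equiv.Perm (Edge n) where
  toFun e := ⟨e.1.map σ, by simpa [Sym2.isDiag_map σ.injective] using e.2⟩
  invFun e := ⟨e.1.map σ.symm, by simpa [Sym2.isDiag_map σ.symm.injective] using e.2⟩
  left_inv e := by ext1; simp [Sym2.map_map]
  right_inv e := by ext1; simp [Sym2.map_map]

/-- A permutation admits a coloring with three colors in which no point has the color of its image,
unless it is fixed: every point has at most two neighbors in the graph of the permutation. -/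
lemma exists_three_coloring {α : Type*} [Fintype α] (f : Equiv.Perm α) :
    ∃ c : α → Fin 3, ∀ a, f a ≠ a → c (f a) ≠ c a := by
  classical
  suffices h : ∀ s : Finset α, ∃ c : α → Fin 3, ∀ a ∈ s, f a ∈ s → f a ≠ a → c (f a) ≠ c a by
    obtain ⟨c, hc⟩ := h Finset.univ
    exact ⟨c, fun a => hc a (Finset.mem_univ _) (Finset.mem_univ _)⟩
  intro s
  induction s using Finset.induction_on with
  | empty => exact ⟨fun _ => 0, by simp⟩
  | insert b s hb ih =>
    obtain ⟨c, hc⟩ := ih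
    obtain ⟨i, hi⟩ : ∃ i : Fin 3, i ≠ c (f b) ∧ i ≠ c (f.symm b) := by
      generalize c (f b) = u
      generalize c (f.symm b) = v
      revert u v
      decide
    refine ⟨Function.update c b i, fun a ha hfa hne => ?_⟩
    by_cases hab : a = b
    · subst hab
      rw [Function.update_of_ne hne, Function.update_self]
      exact hi.1.symm
    · by_cases hfb : f a = b
      · rw [Function.update_of_ne hab, hfb, Function.update_self]
        have : f.symm b = a := by rw [← hfb]; simp
        rw [this] at hi
        exact hi.2
      · rw [Function.update_of_ne hab, Function.update_of_ne hfb]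
        exact hc a (Finset.mem_of_mem_insert_of_ne ha hab)
          (Finset.mem_of_mem_insert_of_ne hfa hfb) hne

open Classical in
/-- The potential edges that are moved by a relabeling. -/
noncomputable def movedEdges {n : ℕ} (σ : Equiv.Perm (Fin n)) : Finset (Edge n) :=
  Finset.univ.filter fun e => edgePerm σ e ≠ e

open Classical in
lemma card_movedEdges_le {n : ℕ} (σ : Equiv.Perm (Fin n)) :
    (movedEdges σ).card ≤ σ.support.card * n := by
  have hsub : movedEdges σ ⊆
      σ.support.biUnion fun v => Finset.univ.filter fun e : Edge n => v ∈ e.1 := by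
    rintro ⟨e, he⟩ hm
    induction e with
    | _ a b =>
      replace hm : edgePerm σ ⟨s(a, b), he⟩ ≠ ⟨s(a, b), he⟩ := (Finset.mem_filter.1 hm).2
      simp only [Finset.mem_biUnion, Equiv.Perm.mem_support, Finset.mem_filter, Finset.mem_univ,
        true_and, Sym2.mem_iff]
      by_cases ha : σ a = a
      · refine ⟨b, fun hb => hm (Subtype.ext ?_), Or.inr rfl⟩
        simp [edgePerm, ha, hb]
      · exact ⟨a, ha, Or.inl rfl⟩
  refine (Finset.card_le_card hsub).trans (Finset.card_biUnion_le_card_mul _ _ _ fun v _ => ?_)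
  rw [card_star]
  omega

open Classical in
/-- The only fixed edge at a moved node `v` is the one between `v` and its image. -/
lemma edgeDeg_le_moved {n : ℕ} (g : SimpleGraph (Fin n)) (σ : Equiv.Perm (Fin n)) {v : Fin n}
    (hv : σ v ≠ v) :
    edgeDeg g v ≤ ((movedEdges σ).filter fun e => e.1 ∈ g.edgeSet ∧ v ∈ e.1).card + 1 := by
  let e₀ : Edge n := ⟨s(v, σ v), by simpa using hv.symm⟩
  refine (Finset.card_le_card (t := insert e₀ ((movedEdges σ).filter fun e =>
    e.1 ∈ g.edgeSet ∧ v ∈ e.1)) ?_).trans (Finset.card_insert_le _ _)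
  intro e he
  simp only [Finset.mem_filter, Finset.mem_univ, true_and] at he
  rw [Finset.mem_insert]
  by_cases hm : edgePerm σ e = e
  · left
    have h1 : σ v ∈ (edgePerm σ e).1 := Sym2.mem_map.2 ⟨v, he.1, rfl⟩
    rw [hm] at h1
    ext1
    exact ((Sym2.mem_and_mem_iff hv.symm).1 ⟨he.1, h1⟩)
  · right
    simp [movedEdges, hm, he]

open Classical in
/-- If all degrees are at least `κ`, then many edges are moved. -/
lemma card_moved_ge {n : ℕ} (g : SimpleGraph (Fin n)) (σ : Equiv.Perm (Fin n)) {κ : ℝ}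
    (hdeg : ∀ v, κ ≤ edgeDeg g v) :
    σ.support.card * (κ - 1) / 2 ≤
      ((movedEdges σ).filter fun e => e.1 ∈ g.edgeSet).card := by
  have h1 : (σ.support.card : ℝ) * (κ - 1) ≤ ∑ v ∈ σ.support,
      (((movedEdges σ).filter fun e => e.1 ∈ g.edgeSet ∧ v ∈ e.1).card : ℝ) := by
    rw [← nsmul_eq_mul]
    refine Finset.card_nsmul_le_sum _ _ _ fun v hv => ?_
    have h2 : (edgeDeg g v : ℝ) ≤
        ((movedEdges σ).filter fun e => e.1 ∈ g.edgeSet ∧ v ∈ e.1).card + 1 := by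
      exact_mod_cast edgeDeg_le_moved g σ (Equiv.Perm.mem_support.1 hv)
    linarith [hdeg v]
  have h2 : ∑ v ∈ σ.support,
      ((movedEdges σ).filter fun e => e.1 ∈ g.edgeSet ∧ v ∈ e.1).card ≤
      ((movedEdges σ).filter fun e => e.1 ∈ g.edgeSet).card * 2 := by
    simp_rw [← Finset.filter_filter]
    have h3 := Finset.sum_card_bipartiteAbove_eq_sum_card_bipartiteBelow
      (s := σ.support) (t := (movedEdges σ).filter fun e => e.1 ∈ g.edgeSet)
      (fun v e => v ∈ e.1)
    simp only [Finset.bipartiteAbove, Finset.bipartiteBelow] at h3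
    rw [h3, ← smul_eq_mul]
    refine Finset.sum_le_card_nsmul _ _ _ fun e _ => ?_
    calc _ ≤ (e.1.toFinset).card := Finset.card_le_card fun v hv => by
            simpa using (Finset.mem_filter.1 hv).2
      _ ≤ 2 := by rw [Sym2.card_toFinset]; split_ifs <;> norm_num
  have h3 : ∑ v ∈ σ.support,
      (((movedEdges σ).filter fun e => e.1 ∈ g.edgeSet ∧ v ∈ e.1).card : ℝ) ≤
      ((movedEdges σ).filter fun e => e.1 ∈ g.edgeSet).card * 2 := by exact_mod_cast h2
  linarith

/-! ### The union bound over the relabelings -/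

open Classical in
/-- For a set `T` of potential edges that is disjoint from its image under `f`, the events that
`e ∈ T` is an edge of `g` and that `f e` is an edge of `H` are independent for different `e`. -/
lemma jointExp_prod_image {n : ℕ} (ρ q x : ℝ) (f : Equiv.Perm (Edge n)) (T : Finset (Edge n))
    (hT : ∀ e ∈ T, f e ∉ T) :
    jointExp ρ q (fun H g => ∏ e ∈ T,
      (1 + if e.1 ∈ g.edgeSet ∧ (f e).1 ∈ H.edgeSet then x else 0)) =
      (1 + x * (ρ ^ 2 * q)) ^ T.card := by
  have hF : ∀ F ∈ T.powerset, jointExp ρ q (fun H g => ∏ e ∈ F,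
      if e.1 ∈ g.edgeSet ∧ (f e).1 ∈ H.edgeSet then x else 0) =
      ∏ e ∈ F, (x * (ρ ^ 2 * q)) := by
    intro F hF
    have hFT : ∀ e ∈ F, e ∈ T := fun e he => Finset.mem_powerset.1 hF he
    -- Each potential edge carries a condition on `g`, if it is in `F`, or on `H`, if it is in the
    -- image of `F`, but not both.
    have h1 : ∀ H g : SimpleGraph (Fin n), (∏ e ∈ F,
        if e.1 ∈ g.edgeSet ∧ (f e).1 ∈ H.edgeSet then x else 0) =
        x ^ F.card * ∏ e : Edge n, ((if e ∈ F then if e.1 ∈ g.edgeSet then 1 else 0 else 1) *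
          (if f.symm e ∈ F then if e.1 ∈ H.edgeSet then 1 else 0 else 1)) := by
      intro H g
      rw [Finset.prod_mul_distrib, ← Equiv.prod_comp f (fun e =>
        (if f.symm e ∈ F then if e.1 ∈ H.edgeSet then (1 : ℝ) else 0 else 1))]
      simp only [Equiv.symm_apply_apply]
      rw [← Finset.prod_mul_distrib, ← Finset.prod_const, ← Finset.prod_filter_mul_prod_filter_not
        Finset.univ (fun e => e ∈ F)]
      rw [Finset.prod_eq_one (s := Finset.univ.filter fun e => e ∉ F), mul_one,
        Finset.filter_mem_eq_inter, Finset.univ_inter, ← Finset.prod_mul_distrib]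
      · refine Finset.prod_congr rfl fun e he => ?_
        by_cases h1 : e.1 ∈ g.edgeSet <;> by_cases h2 : (f e).1 ∈ H.edgeSet <;>
          simp only [h1, h2, he] <;> simp
      · intro e he
        simp [(Finset.mem_filter.1 he).2]
    simp_rw [h1]
    rw [jointExp_mul]
    refine (congrArg (x ^ F.card * ·) (Eq.trans (by congr!) (jointExp_prod ρ q (fun e P Q =>
      (if e ∈ F then if Q then 1 else 0 else 1) *
          (if f.symm e ∈ F then if P then 1 else 0 else 1))))).trans ?_
    trans x ^ F.card * ∏ e : Edge n,
      ((if e ∈ F then ρ * q else 1) * (if f.symm e ∈ F then ρ else 1))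
    · congr 1
      refine Finset.prod_congr rfl fun e _ => ?_
      by_cases h1 : e ∈ F <;> by_cases h2 : f.symm e ∈ F
      · have := hT _ (hFT _ h2)
        rw [Equiv.apply_symm_apply] at this
        exact absurd (hFT _ h1) this
      · simp [h1, h2]
      · simp [h1, h2]; ring
      · simp [h1, h2]; ring
    rw [Finset.prod_mul_distrib, ← Equiv.prod_comp f (fun e => (if f.symm e ∈ F then ρ else 1))]
    simp only [Equiv.symm_apply_apply, Finset.prod_ite_mem, Finset.univ_inter, Finset.prod_const]
    rw [← mul_pow, ← mul_pow]
    congr 1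
    ring
  simp_rw [Finset.prod_one_add]
  rw [jointExp_sum, Finset.sum_congr rfl hF, ← Finset.prod_one_add, Finset.prod_const]

open Classical in
/-- If `σ` makes `g` a subgraph of `H` and all degrees of `g` are at least `κ`, then one of three
products, one for each color of potential edges, is large. By `jointExp_prod_image` their
expectations are known if no moved edge has the color of its image. -/
lemma indicator_le_sum_prod {n : ℕ} {ρ κ : ℝ} (hρ0 : 0 < ρ) (hρ1 : ρ ≤ 1)
    (σ : Equiv.Perm (Fin n)) (c : Edge n → Fin 3) (H g : SimpleGraph (Fin n))
    (hdeg : ∀ v, κ ≤ edgeDeg g v) (hg : g ≤ H.comap σ) :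
    1 ≤ ∑ i : Fin 3, (ρ ^ ((κ - 1) / 6)) ^ σ.support.card *
      ∏ e ∈ (movedEdges σ).filter (fun e => c e = i),
        (1 + if e.1 ∈ g.edgeSet ∧ (edgePerm σ e).1 ∈ H.edgeSet then ρ⁻¹ else 0) := by
  have hρ : 1 ≤ ρ⁻¹ := (one_le_inv₀ hρ0).2 hρ1
  have hmap : ∀ e : Edge n, e.1 ∈ g.edgeSet → (edgePerm σ e).1 ∈ H.edgeSet := by
    rintro ⟨e, he⟩ h
    induction e with
    | _ a b => exact hg h
  have hmoved := card_moved_ge g σ hdeg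
  rw [Finset.card_eq_sum_card_fiberwise (f := c) (t := Finset.univ) (fun _ _ => by simp)] at hmoved
  push_cast at hmoved
  -- Some color has at least a third of the moved edges of `g`.
  obtain ⟨i, -, hi⟩ : ∃ i ∈ (Finset.univ : Finset (Fin 3)),
      σ.support.card * (κ - 1) / 6 ≤
        ((((movedEdges σ).filter fun e => e.1 ∈ g.edgeSet).filter fun e => c e = i).card : ℝ) := by
    refine Finset.exists_le_of_sum_le Finset.univ_nonempty ?_
    rw [Finset.sum_const]
    simp only [Finset.card_univ, Fintype.card_fin, nsmul_eq_mul]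
    push_cast
    linarith
  have hnn : ∀ j ∈ (Finset.univ : Finset (Fin 3)), 0 ≤ (ρ ^ ((κ - 1) / 6)) ^ σ.support.card *
      ∏ e ∈ (movedEdges σ).filter (fun e => c e = j),
        (1 + if e.1 ∈ g.edgeSet ∧ (edgePerm σ e).1 ∈ H.edgeSet then ρ⁻¹ else 0) := by
    intro j _
    refine mul_nonneg (by positivity) (Finset.prod_nonneg fun e _ => ?_)
    split_ifs <;> positivity
  refine le_trans ?_ (Finset.single_le_sum hnn (Finset.mem_univ i))
  set N := ((((movedEdges σ).filter fun e => e.1 ∈ g.edgeSet).filter fun e => c e = i).card) with hN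
  have h1 : ρ⁻¹ ^ N ≤ ∏ e ∈ (movedEdges σ).filter (fun e => c e = i),
        (1 + if e.1 ∈ g.edgeSet ∧ (edgePerm σ e).1 ∈ H.edgeSet then ρ⁻¹ else 0) := by
    rw [hN, ← Finset.prod_const, Finset.filter_filter]
    have : ((movedEdges σ).filter fun e => e.1 ∈ g.edgeSet ∧ c e = i) =
        ((movedEdges σ).filter fun e => c e = i).filter fun e => e.1 ∈ g.edgeSet := by
      rw [Finset.filter_filter]
      exact Finset.filter_congr fun e _ => and_comm
    rw [this, Finset.prod_filter]
    refine Finset.prod_le_prod (fun e _ => by split_ifs <;> positivity) fun e _ => ?_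
    by_cases he : e.1 ∈ g.edgeSet
    · simp [he, hmap e he]
    · simp [he]
  have h2 : (ρ ^ ((κ - 1) / 6)) ^ σ.support.card = (ρ⁻¹ ^ (σ.support.card * (κ - 1) / 6))⁻¹ := by
    rw [Real.inv_rpow hρ0.le, inv_inv, ← Real.rpow_natCast, ← Real.rpow_mul hρ0.le]
    congr 1
    ring
  have h3 : ρ⁻¹ ^ (σ.support.card * (κ - 1) / 6) ≤ ρ⁻¹ ^ N := by
    rw [← Real.rpow_natCast]
    exact Real.rpow_le_rpow_of_exponent_le hρ hi
  have h4 : 0 < ρ⁻¹ ^ (σ.support.card * (κ - 1) / 6) := by positivity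
  rw [h2]
  calc (1 : ℝ) = (ρ⁻¹ ^ (σ.support.card * (κ - 1) / 6))⁻¹ *
        ρ⁻¹ ^ (σ.support.card * (κ - 1) / 6) := by field_simp
    _ ≤ _ := mul_le_mul_of_nonneg_left (h3.trans h1) (by positivity)

open Classical in
/-- The generating function of the permutations by their number of moved points. -/
lemma sum_perm_pow_support_le {n : ℕ} {A : ℝ} (hA : 0 ≤ A) :
    ∑ σ : Equiv.Perm (Fin n), A ^ σ.support.card ≤ (1 + n * A) ^ n := by
  have h1 : ∀ σ : Equiv.Perm (Fin n), A ^ σ.support.card =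
      ∏ v, if σ v ≠ v then A else 1 := by
    intro σ
    rw [← Finset.prod_filter, Finset.prod_const]
    congr 2
  calc ∑ σ : Equiv.Perm (Fin n), A ^ σ.support.card
      = ∑ σ : Equiv.Perm (Fin n), ∏ v, if (σ : Fin n → Fin n) v ≠ v then A else 1 :=
        Finset.sum_congr rfl fun σ _ => h1 σ
    -- The sum over all functions, unlike the one over the permutations, is a product over the nodes.
    _ = ∑ f ∈ Finset.univ.image (fun σ : Equiv.Perm (Fin n) => (⇑σ : Fin n → Fin n)),
        ∏ v, if f v ≠ v then A else 1 := by
        rw [Finset.sum_image fun σ _ τ _ h => DFunLike.coe_injective h]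
    _ ≤ ∑ f : Fin n → Fin n, ∏ v, if f v ≠ v then A else 1 := by
        refine Finset.sum_le_sum_of_subset_of_nonneg (Finset.subset_univ _) fun f _ _ => ?_
        exact Finset.prod_nonneg fun v _ => by split_ifs <;> positivity
    _ = ∏ v : Fin n, ∑ w : Fin n, if w ≠ v then A else 1 := by
        rw [Finset.prod_univ_sum, Fintype.piFinset_univ]
    _ ≤ ∏ v : Fin n, (1 + n * A) := by
        refine Finset.prod_le_prod (fun v _ => Finset.sum_nonneg fun w _ => by
          split_ifs <;> positivity) fun v _ => ?_
        calc ∑ w : Fin n, (if w ≠ v then A else 1)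
            ≤ ∑ w : Fin n, ((if w = v then 1 else 0) + A) :=
              Finset.sum_le_sum fun w _ => by split_ifs <;> simp_all
          _ = 1 + n * A := by simp [Finset.sum_add_distrib]
    _ = (1 + n * A) ^ n := by simp

open Classical in
/-- The expected number of nontrivial relabelings that make `g` a subgraph of `H`, together with the
expected number of nodes of small degree in `g`, bounds the probability that `g` is not rigid. -/
lemma jointExp_nonrigid_le {n : ℕ} {ρ q x κ : ℝ} (hρ0 : 0 < ρ) (hρ1 : ρ ≤ 1) (hq0 : 0 ≤ q)
    (hq1 : q ≤ 1) (hx0 : 0 < x) (hx1 : x ≤ 1) :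
    jointExp ρ q (fun H g : SimpleGraph (Fin n) => if IsRigid H g then 0 else 1) ≤
      n * (x ^ (-κ) * (1 - ρ * q * (1 - x)) ^ (n - 1)) +
      3 * ((1 + n * (ρ ^ ((κ - 1) / 6) * (1 + ρ * q) ^ n)) ^ n - 1) := by
  choose c hc using fun σ : Equiv.Perm (Fin n) => exists_three_coloring (edgePerm σ)
  set B : ℝ := ρ ^ ((κ - 1) / 6) with hB
  have hB0 : 0 < B := Real.rpow_pos_of_pos hρ0 _
  have hind : ∀ H g : SimpleGraph (Fin n), (if IsRigid H g then (0 : ℝ) else 1) ≤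
      ∑ v : Fin n, x ^ (-κ) * x ^ edgeDeg g v +
      ∑ σ ∈ (Finset.univ : Finset (Equiv.Perm (Fin n))).erase 1, ∑ i : Fin 3,
        B ^ σ.support.card * ∏ e ∈ (movedEdges σ).filter (fun e => c σ e = i),
          (1 + if e.1 ∈ g.edgeSet ∧ (edgePerm σ e).1 ∈ H.edgeSet then ρ⁻¹ else 0) := by
    intro H g
    have hn1 : ∀ v ∈ (Finset.univ : Finset (Fin n)), 0 ≤ x ^ (-κ) * x ^ edgeDeg g v :=
      fun v _ => by positivity
    have hn2 : ∀ σ ∈ (Finset.univ : Finset (Equiv.Perm (Fin n))).erase 1, 0 ≤ ∑ i : Fin 3,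
        B ^ σ.support.card * ∏ e ∈ (movedEdges σ).filter (fun e => c σ e = i),
          (1 + if e.1 ∈ g.edgeSet ∧ (edgePerm σ e).1 ∈ H.edgeSet then ρ⁻¹ else 0) :=
      fun σ _ => Finset.sum_nonneg fun i _ => mul_nonneg (by positivity)
        (Finset.prod_nonneg fun e _ => by split_ifs <;> positivity)
    have hs1 := Finset.sum_nonneg hn1
    have hs2 := Finset.sum_nonneg hn2
    split_ifs with hr
    · exact add_nonneg hs1 hs2
    · simp only [IsRigid, not_forall] at hr
      obtain ⟨σ, hσ, hne⟩ := hr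
      by_cases hdeg : ∀ v, κ ≤ edgeDeg g v
      · have h1 := indicator_le_sum_prod hρ0 hρ1 σ (c σ) H g hdeg hσ
        have h2 := Finset.single_le_sum hn2 (Finset.mem_erase.2 ⟨hne, Finset.mem_univ σ⟩)
        linarith
      · push Not at hdeg
        obtain ⟨v, hv⟩ := hdeg
        have h2 := Finset.single_le_sum hn1 (Finset.mem_univ v)
        have h3 : 1 ≤ x ^ (-κ) * x ^ edgeDeg g v := by
          rw [← Real.rpow_natCast, ← Real.rpow_add hx0]
          exact Real.one_le_rpow_of_pos_of_le_one_of_nonpos hx0 hx1 (by linarith)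
        linarith
  refine (jointExp_mono hρ0.le hρ1 hq0 hq1 hind).trans ?_
  rw [jointExp_add, jointExp_sum, jointExp_sum]
  refine add_le_add ?_ ?_
  · refine le_of_eq ?_
    rw [Finset.sum_congr rfl fun v _ => (jointExp_mul ρ q (x ^ (-κ)) fun _ g =>
      x ^ edgeDeg g v).trans (by rw [jointExp_pow_edgeDeg_right])]
    simp
  · have hterm : ∀ σ ∈ (Finset.univ : Finset (Equiv.Perm (Fin n))).erase 1,
        jointExp ρ q (fun H g : SimpleGraph (Fin n) => ∑ i : Fin 3,
        B ^ σ.support.card * ∏ e ∈ (movedEdges σ).filter (fun e => c σ e = i),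
          (1 + if e.1 ∈ g.edgeSet ∧ (edgePerm σ e).1 ∈ H.edgeSet then ρ⁻¹ else 0)) ≤
        3 * (B * (1 + ρ * q) ^ n) ^ σ.support.card := by
      intro σ _
      rw [jointExp_sum]
      have : ∀ i ∈ (Finset.univ : Finset (Fin 3)), jointExp ρ q (fun H g : SimpleGraph (Fin n) =>
          B ^ σ.support.card * ∏ e ∈ (movedEdges σ).filter (fun e => c σ e = i),
          (1 + if e.1 ∈ g.edgeSet ∧ (edgePerm σ e).1 ∈ H.edgeSet then ρ⁻¹ else 0)) ≤
          (B * (1 + ρ * q) ^ n) ^ σ.support.card := by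
        intro i _
        rw [jointExp_mul, jointExp_prod_image, mul_pow, ← pow_mul]
        · refine mul_le_mul_of_nonneg_left ?_ (by positivity)
          -- With the weight `ρ⁻¹`, the base `1 + ρ q` gives only a factor `exp (n ρ q)` for each
          -- moved node, where `n ρ q` is about the mean degree of `g`.
          have h1 : ρ⁻¹ * (ρ ^ 2 * q) = ρ * q := by field_simp
          rw [h1]
          refine pow_le_pow_right₀ (by nlinarith) ?_
          rw [mul_comm n]
          exact (Finset.card_filter_le _ _).trans (card_movedEdges_le σ)
        · intro e he hfe
          simp only [Finset.mem_filter, movedEdges, Finset.mem_univ, true_and] at he hfe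
          exact hc σ e he.1 (hfe.2.trans he.2.symm)
      refine (Finset.sum_le_sum this).trans (le_of_eq ?_)
      simp
    refine (Finset.sum_le_sum hterm).trans ?_
    rw [← Finset.mul_sum]
    refine mul_le_mul_of_nonneg_left ?_ (by norm_num)
    have h1 := sum_perm_pow_support_le (n := n) (A := B * (1 + ρ * q) ^ n) (by positivity)
    rw [← Finset.add_sum_erase _ _ (Finset.mem_univ 1)] at h1
    simp only [Equiv.Perm.support_one, Finset.card_empty, pow_zero] at h1
    linarith

open Classical in
/-- The probabilistic method: there is a graph with small degrees whose random subgraphs are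
rigid with high probability. -/
lemma exists_graph {n : ℕ} {ρ q x κ y Δ : ℝ} (hρ0 : 0 < ρ) (hρ1 : ρ ≤ 1) (hq0 : 0 ≤ q)
    (hq1 : q ≤ 1) (hx0 : 0 < x) (hx1 : x ≤ 1) (hy : 1 ≤ y) {u : ℝ}
    (hu : n * (y ^ (-Δ) * (1 + ρ * (y - 1)) ^ (n - 1)) +
      (n * (x ^ (-κ) * (1 - ρ * q * (1 - x)) ^ (n - 1)) +
      3 * ((1 + n * (ρ ^ ((κ - 1) / 6) * (1 + ρ * q) ^ n)) ^ n - 1)) ≤ u) (hu1 : u < 1) :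
    ∃ H : SimpleGraph (Fin n), (∀ v, (edgeDeg H v : ℝ) ≤ Δ) ∧ nonrigidProb q H ≤ u := by
  have hy0 : 0 < y := by linarith
  have h1 : jointExp ρ q (fun H _ : SimpleGraph (Fin n) => ∑ v : Fin n, y ^ (-Δ) * y ^ edgeDeg H v)
      = n * (y ^ (-Δ) * (1 + ρ * (y - 1)) ^ (n - 1)) := by
    rw [jointExp_sum, Finset.sum_congr rfl fun v _ => (jointExp_mul ρ q (y ^ (-Δ)) fun H _ =>
      y ^ edgeDeg H v).trans (by rw [jointExp_pow_edgeDeg_left])]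
    simp
  have h2 : jointExp ρ q (fun H g : SimpleGraph (Fin n) => if IsRigid H g then 0 else 1) =
      ∑ H : SimpleGraph (Fin n), rgProb (scaledAdj ρ ⊤) H * nonrigidProb q H := by
    unfold jointExp nonrigidProb
    simp only [Finset.mul_sum, mul_assoc]
  have h3 : ∑ H : SimpleGraph (Fin n), rgProb (scaledAdj ρ ⊤) H *
      ((∑ v : Fin n, y ^ (-Δ) * y ^ edgeDeg H v) + nonrigidProb q H) ≤
      ∑ H : SimpleGraph (Fin n), rgProb (scaledAdj ρ ⊤) H * u := by
    rw [← Finset.sum_mul, sum_rgProb_scaledAdj, one_mul]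
    simp only [mul_add, Finset.sum_add_distrib]
    rw [← h2, ← jointExp_left ρ q, h1]
    exact (add_le_add_right (jointExp_nonrigid_le hρ0 hρ1 hq0 hq1 hx0 hx1) _).trans hu
  obtain ⟨H, hH⟩ : ∃ H : SimpleGraph (Fin n),
      (∑ v : Fin n, y ^ (-Δ) * y ^ edgeDeg H v) + nonrigidProb q H ≤ u := by
    by_contra! hcon
    have hle : ∀ H ∈ (Finset.univ : Finset (SimpleGraph (Fin n))),
        0 ≤ rgProb (scaledAdj ρ ⊤) H * (((∑ v : Fin n, y ^ (-Δ) * y ^ edgeDeg H v) +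
          nonrigidProb q H) - u) := fun H _ =>
      mul_nonneg (rgProb_scaledAdj_nonneg hρ0.le hρ1 _ _) (by linarith [hcon H])
    have hsum : ∑ H : SimpleGraph (Fin n), rgProb (scaledAdj ρ ⊤) H *
        (((∑ v : Fin n, y ^ (-Δ) * y ^ edgeDeg H v) + nonrigidProb q H) - u) = 0 := by
      refine le_antisymm ?_ (Finset.sum_nonneg hle)
      simp only [mul_sub, Finset.sum_sub_distrib]
      linarith
    have hz := (Finset.sum_eq_zero_iff_of_nonneg hle).1 hsum
    have hw : ∀ H : SimpleGraph (Fin n), rgProb (scaledAdj ρ ⊤) H = 0 := fun H =>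
      (mul_eq_zero.1 (hz H (Finset.mem_univ H))).resolve_right (by linarith [hcon H])
    have := sum_rgProb_scaledAdj ρ (⊤ : SimpleGraph (Fin n))
    simp [hw] at this
  have hnn1 : ∀ v ∈ (Finset.univ : Finset (Fin n)), 0 ≤ y ^ (-Δ) * y ^ edgeDeg H v :=
    fun v _ => by positivity
  have hnn2 : 0 ≤ nonrigidProb q H := Finset.sum_nonneg fun g _ =>
    mul_nonneg (rgProb_scaledAdj_nonneg hq0 hq1 _ _) (by split_ifs <;> norm_num)
  refine ⟨H, fun v => ?_, by linarith [Finset.sum_nonneg hnn1]⟩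
  by_contra! hv
  have h4 := Finset.single_le_sum hnn1 (Finset.mem_univ v)
  have h5 : 1 ≤ y ^ (-Δ) * y ^ edgeDeg H v := by
    rw [← Real.rpow_natCast, ← Real.rpow_add hy0]
    exact Real.one_le_rpow hy (by linarith)
  linarith

/-- The empty graph has only empty subgraphs, which are not rigid. -/
lemma one_le_nonrigidProb_bot {n : ℕ} (hn : 2 ≤ n) (q : ℝ) (hq0 : 0 ≤ q) (hq1 : q ≤ 1) :
    1 ≤ nonrigidProb q (⊥ : SimpleGraph (Fin n)) := by
  classical
  have hr : ¬ IsRigid (⊥ : SimpleGraph (Fin n)) ⊥ := by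
    intro h
    have := h (Equiv.swap ⟨0, by omega⟩ ⟨1, by omega⟩) bot_le
    rw [Equiv.swap_eq_one_iff] at this
    simp at this
  have h1 : rgProb (scaledAdj q (⊥ : SimpleGraph (Fin n))) ⊥ = 1 := by
    rw [rgProb_scaledAdj]
    exact Finset.prod_eq_one fun e _ => by simp [edgeFactor]
  have := Finset.single_le_sum (f := fun g => rgProb (scaledAdj q (⊥ : SimpleGraph (Fin n))) g *
    if IsRigid ⊥ g then 0 else 1) (fun g _ => mul_nonneg (rgProb_scaledAdj_nonneg hq0 hq1 _ _)
      (by split_ifs <;> norm_num)) (Finset.mem_univ ⊥)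
  simpa [h1, hr, nonrigidProb] using this

/-! ### Asymptotics -/

lemma sq_le_exp {t : ℝ} (ht : 0 ≤ t) : t ^ 2 ≤ Real.exp t := by
  have := Real.sum_le_exp_of_nonneg ht 4
  simp only [Finset.sum_range_succ, Finset.sum_range_zero, Nat.factorial] at this
  push_cast at this
  nlinarith [mul_nonneg ht (sq_nonneg (t - 3 / 2))]

lemma log_sq_div_le_one (n : ℕ) (hn : 1 ≤ n) : Real.log n ^ 2 / n ≤ 1 := by
  have hn0 : (0 : ℝ) < n := by exact_mod_cast hn
  rw [div_le_one hn0]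
  have := sq_le_exp (Real.log_nonneg (by exact_mod_cast hn : (1 : ℝ) ≤ n))
  rwa [Real.exp_log hn0] at this

/-- A bound for the failure probability in terms of `ℓ = log n`. The first two summands account for
large degrees of `H` and small degrees of `g`, and the third one for the relabelings. -/
noncomputable def failureBound (ε s c κ₁ ℓ : ℝ) : ℝ :=
  Real.exp (ℓ - κ₁ * (Real.exp ℓ / (s * ℓ))) + (Real.exp (1 + ε / 2 - ε / 8 * ℓ) +
    3 * (Real.exp (Real.exp ((3 + ε / 2) * ℓ - (c * ℓ - 1) / 6 *
      Real.log (s * ℓ / (1 + ε / 2)))) - 1))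

lemma tendsto_failureBound {ε s c κ₁ : ℝ} (hε : 0 < ε) (hs : 0 < s) (hc : 0 < c) (hκ₁ : 0 < κ₁) :
    Tendsto (failureBound ε s c κ₁) atTop (𝓝 0) := by
  have h1 : Tendsto (fun ℓ : ℝ => ℓ - κ₁ * (Real.exp ℓ / (s * ℓ))) atTop atBot := by
    have h2 : Tendsto (fun ℓ : ℝ => ℓ * (κ₁ / s * (Real.exp ℓ / ℓ ^ 2) + -1)) atTop atTop :=
      tendsto_id.atTop_mul_atTop₀ (tendsto_atTop_add_const_right _ _
        ((Real.tendsto_exp_div_pow_atTop 2).const_mul_atTop (by positivity)))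
    refine (tendsto_neg_atTop_atBot.comp h2).congr' ?_
    filter_upwards [eventually_gt_atTop 0] with ℓ hℓ
    simp only [Function.comp_apply]
    field_simp
    ring
  have h3 : Tendsto (fun ℓ : ℝ => 1 + ε / 2 - ε / 8 * ℓ) atTop atBot := by
    have : Tendsto (fun ℓ : ℝ => ε / 8 * ℓ) atTop atTop :=
      tendsto_id.const_mul_atTop (by positivity)
    simpa [sub_eq_add_neg] using
      tendsto_atBot_add_const_left _ (1 + ε / 2) (tendsto_neg_atTop_atBot.comp this)
  have h4 : Tendsto (fun ℓ : ℝ => (3 + ε / 2) * ℓ - (c * ℓ - 1) / 6 *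
      Real.log (s * ℓ / (1 + ε / 2))) atTop atBot := by
    have h5 : Tendsto (fun ℓ : ℝ => Real.log (s * ℓ / (1 + ε / 2))) atTop atTop :=
      Real.tendsto_log_atTop.comp ((tendsto_id.const_mul_atTop hs).atTop_div_const (by positivity))
    have h6 : Tendsto (fun ℓ : ℝ => (c - ℓ⁻¹) / 6) atTop (𝓝 ((c - 0) / 6)) :=
      (tendsto_const_nhds.sub tendsto_inv_atTop_zero).div_const 6
    have h7 : Tendsto (fun ℓ : ℝ => (c - ℓ⁻¹) / 6 * Real.log (s * ℓ / (1 + ε / 2)))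
        atTop atTop := h6.pos_mul_atTop (by rw [sub_zero]; positivity) h5
    have h8 : Tendsto (fun ℓ : ℝ => ℓ * ((c - ℓ⁻¹) / 6 * Real.log (s * ℓ / (1 + ε / 2)) +
        -(3 + ε / 2))) atTop atTop :=
      tendsto_id.atTop_mul_atTop₀ (tendsto_atTop_add_const_right _ _ h7)
    refine (tendsto_neg_atTop_atBot.comp h8).congr' ?_
    filter_upwards [eventually_gt_atTop 0] with ℓ hℓ
    simp only [Function.comp_apply]
    generalize Real.log (s * ℓ / (1 + ε / 2)) = l
    field_simp
    ring
  have h9 := Real.continuous_exp.continuousAt.tendsto.comp (Real.tendsto_exp_atBot.comp h4)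
  have h10 := (Real.tendsto_exp_atBot.comp h1).add ((Real.tendsto_exp_atBot.comp h3).add
    ((h9.sub_const 1).const_mul 3))
  unfold failureBound
  simpa [Function.comp_def] using h10

lemma one_add_pow_le_exp {z : ℝ} (hz : -1 ≤ z) (k : ℕ) : (1 + z) ^ k ≤ Real.exp (z * k) := by
  rw [mul_comm, Real.exp_nat_mul]
  exact pow_le_pow_left₀ (by linarith) (by linarith [Real.add_one_le_exp z]) k

/-- The constants for which the exponential moment method applies to the degrees: `x` and `c` for
the lower tail of a mean degree `(1 + ε / 2) log n`, and `y` and `κ₁` for the upper tail. -/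
lemma exists_constants {ε : ℝ} (hε : 0 < ε) :
    ∃ x c y κ₁ : ℝ, 0 < x ∧ x ≤ 1 ∧ 0 < c ∧ 1 ≤ y ∧ 0 < κ₁ ∧
      (1 + ε / 2) * (1 - x) = 1 + ε / 4 ∧ c * -Real.log x = ε / 8 ∧
      (1 + ε) * Real.log y - (1 + ε / 2) * (y - 1) = κ₁ := by
  have hb : 0 < 1 + ε / 2 := by linarith
  have hx0 : 0 < ε / 4 / (1 + ε / 2) := by positivity
  have hx1 : ε / 4 / (1 + ε / 2) < 1 := by rw [div_lt_one hb]; linarith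
  have hlog : 0 < -Real.log (ε / 4 / (1 + ε / 2)) := neg_pos.2 (Real.log_neg hx0 hx1)
  have hy1 : 1 < (1 + ε) / (1 + ε / 2) := by rw [one_lt_div hb]; linarith
  refine ⟨ε / 4 / (1 + ε / 2), ε / 8 / -Real.log (ε / 4 / (1 + ε / 2)), (1 + ε) / (1 + ε / 2), _,
    hx0, hx1.le, div_pos (by positivity) hlog, hy1.le, ?_, ?_, ?_, rfl⟩
  · have h1 := Real.log_lt_sub_one_of_pos (x := ((1 + ε) / (1 + ε / 2))⁻¹) (by positivity)
      (inv_lt_one_of_one_lt₀ hy1).ne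
    rw [Real.log_inv] at h1
    have h2 : (1 + ε / 2) * ((1 + ε) / (1 + ε / 2) - 1) =
        (1 + ε) * (1 - ((1 + ε) / (1 + ε / 2))⁻¹) := by field_simp
    rw [h2, ← mul_sub]
    exact mul_pos (by linarith) (by linarith)
  · field_simp
    ring
  · exact div_mul_cancel₀ _ hlog.ne'

/-- For large `n` there is a graph with degrees at most `(1 + ε) n / (s log n)`, whose random
subgraphs with edge probability `s log² n / n` are rigid with high probability. -/
lemma exists_graph_of_large {ε s : ℝ} (hε : 0 < ε) (hs0 : 0 < s) (hs1 : s ≤ 1) :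
    ∃ u : ℕ → ℝ, Tendsto u atTop (𝓝 0) ∧ ∀ᶠ n : ℕ in atTop, ∃ H : SimpleGraph (Fin n),
      (∀ v, (edgeDeg H v : ℝ) ≤ (1 + ε) * n / (s * Real.log n)) ∧
      nonrigidProb (s * (Real.log n ^ 2 / n)) H ≤ u n := by
  obtain ⟨x, c, y, κ₁, hx0, hx1, hc, hy, hκ₁, hxb, hcx, hyκ⟩ := exists_constants hε
  have hlog : Tendsto (fun n : ℕ => Real.log n) atTop atTop :=
    Real.tendsto_log_atTop.comp tendsto_natCast_atTop_atTop
  have hu : Tendsto (fun n : ℕ => failureBound ε s c κ₁ (Real.log n)) atTop (𝓝 0) :=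
    (tendsto_failureBound hε hs0 hc hκ₁).comp hlog
  refine ⟨_, hu, ?_⟩
  filter_upwards [hlog.eventually_ge_atTop ((1 + ε / 2) / s), eventually_ge_atTop 2,
    hu.eventually_lt_const one_pos] with n hρn hn hu1
  have hn0 : (0 : ℝ) < n := by exact_mod_cast (by omega : 0 < n)
  have hq1' := log_sq_div_le_one n (by omega)
  have hexp : Real.exp (Real.log n) = n := Real.exp_log hn0
  have hLn : Real.log n ≤ n := Real.log_le_self hn0.le
  unfold failureBound at hu1 ⊢
  rw [hexp] at hu1 ⊢
  set L := Real.log n with hL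
  have hL0 : 0 < L := lt_of_lt_of_le (by positivity) hρn
  have hb : 0 < 1 + ε / 2 := by linarith
  have hρ0 : 0 < (1 + ε / 2) / (s * L) := by positivity
  have hρ1 : (1 + ε / 2) / (s * L) ≤ 1 := by
    rw [div_le_one (by positivity)]
    rw [div_le_iff₀ hs0] at hρn
    linarith
  have hq0 : 0 ≤ s * (L ^ 2 / n) := by positivity
  have hq1 : s * (L ^ 2 / n) ≤ 1 := mul_le_one₀ hs1 (by positivity) hq1'
  have hρq : (1 + ε / 2) / (s * L) * (s * (L ^ 2 / n)) = (1 + ε / 2) * L / n := by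
    field_simp
  have hρq1 : (1 + ε / 2) * L / n ≤ 1 := by
    rw [← hρq]; exact mul_le_one₀ hρ1 hq0 hq1
  have hρq0 : 0 < (1 + ε / 2) * L / n := by positivity
  have hcast : ((n - 1 : ℕ) : ℝ) = n - 1 := by
    rw [Nat.cast_sub (by omega)]; norm_num
  refine exists_graph (κ := c * L) hρ0 hρ1 hq0 hq1 hx0 hx1 hy ?_ hu1
  rw [hρq]
  refine add_le_add ?_ (add_le_add ?_ ?_)
  · have h1 : (1 + (1 + ε / 2) / (s * L) * (y - 1)) ^ (n - 1) ≤
        Real.exp ((1 + ε / 2) / (s * L) * (y - 1) * n) := by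
      have h0 : 0 ≤ (1 + ε / 2) / (s * L) * (y - 1) := mul_nonneg hρ0.le (by linarith)
      refine (one_add_pow_le_exp (by linarith) _).trans (Real.exp_le_exp.2 ?_)
      exact mul_le_mul_of_nonneg_left (by rw [hcast]; linarith) h0
    calc _ ≤ n * (y ^ (-((1 + ε) * n / (s * L))) *
          Real.exp ((1 + ε / 2) / (s * L) * (y - 1) * n)) := by gcongr
      _ = Real.exp (L - κ₁ * (n / (s * L))) := by
        nth_rewrite 1 [← hexp]
        rw [Real.rpow_def_of_pos (by linarith), ← Real.exp_add, ← Real.exp_add, ← hyκ]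
        congr 1
        field_simp
        ring
  · have h1 : (1 - (1 + ε / 2) * L / n * (1 - x)) ^ (n - 1) ≤
        Real.exp (-(1 + ε / 4) * L + (1 + ε / 2)) := by
      have h0 : (1 + ε / 2) * L / n * (1 - x) ≤ 1 :=
        mul_le_one₀ hρq1 (by linarith) (by linarith)
      rw [sub_eq_add_neg]
      refine (one_add_pow_le_exp (by linarith) _).trans (Real.exp_le_exp.2 ?_)
      rw [hcast]
      have h2 : -((1 + ε / 2) * L / n * (1 - x)) * (n - 1) =
          -((1 + ε / 2) * (1 - x)) * L + (1 + ε / 2) * ((1 - x) * (L / n)) := by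
        field_simp
        ring
      rw [h2, hxb]
      have h3 : (1 - x) * (L / n) ≤ 1 :=
        mul_le_one₀ (by linarith) (by positivity) ((div_le_one hn0).2 hLn)
      linarith [mul_le_mul_of_nonneg_left h3 hb.le]
    calc _ ≤ n * (x ^ (-(c * L)) * Real.exp (-(1 + ε / 4) * L + (1 + ε / 2))) := by gcongr
      _ = Real.exp (1 + ε / 2 - ε / 8 * L) := by
        nth_rewrite 1 [← hexp]
        rw [Real.rpow_def_of_pos hx0, ← Real.exp_add, ← Real.exp_add]
        congr 1
        linear_combination L * hcx
  · refine mul_le_mul_of_nonneg_left (sub_le_sub_right ?_ 1) (by norm_num)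
    have h1 : (1 + (1 + ε / 2) * L / n) ^ n ≤ Real.exp ((1 + ε / 2) * L) := by
      refine (one_add_pow_le_exp (by linarith) _).trans (le_of_eq ?_)
      congr 1
      field_simp
    have hA0 : 0 ≤ ((1 + ε / 2) / (s * L)) ^ ((c * L - 1) / 6) *
        (1 + (1 + ε / 2) * L / n) ^ n := by positivity
    have h2 : 0 ≤ n * (((1 + ε / 2) / (s * L)) ^ ((c * L - 1) / 6) *
        (1 + (1 + ε / 2) * L / n) ^ n) := by positivity
    refine (one_add_pow_le_exp (by linarith) _).trans (Real.exp_le_exp.2 ?_)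
    calc _ ≤ n * (((1 + ε / 2) / (s * L)) ^ ((c * L - 1) / 6) *
          Real.exp ((1 + ε / 2) * L)) * n := by gcongr
      _ = Real.exp ((3 + ε / 2) * L - (c * L - 1) / 6 * Real.log (s * L / (1 + ε / 2))) := by
        have h3 : Real.log ((1 + ε / 2) / (s * L)) = -Real.log (s * L / (1 + ε / 2)) := by
          rw [← Real.log_inv, inv_div]
        rw [Real.rpow_def_of_pos hρ0, h3]
        nth_rewrite 1 2 [← hexp]
        rw [← Real.exp_add, ← Real.exp_add, ← Real.exp_add]
        congr 1
        ring

/-! ### The parameter matrix and the estimator -/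

/-- The graph of the nonzero entries of a matrix, with the diagonal ignored and the relation
symmetrized. -/
def supportGraph {n : ℕ} (P : Matrix (Fin n) (Fin n) ℝ) : SimpleGraph (Fin n) :=
  SimpleGraph.fromRel fun i j => P i j ≠ 0

lemma supportGraph_scaledAdj {n : ℕ} {p : ℝ} (hp : p ≠ 0) (H : SimpleGraph (Fin n)) :
    supportGraph (scaledAdj p H) = H := by
  ext u v
  simp only [supportGraph, SimpleGraph.fromRel_adj, scaledAdj, Matrix.of_apply, ne_eq,
    ite_eq_right_iff, Classical.not_imp, hp, not_false_eq_true, and_true, H.adj_comm v u, or_self]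
  exact ⟨fun h => h.2, fun h => ⟨h.ne, h⟩⟩

lemma isParameterMatrix_scaledAdj {n : ℕ} {p : ℝ} (hp0 : 0 ≤ p) (hp1 : p ≤ 1)
    (H : SimpleGraph (Fin n)) : IsParameterMatrix (scaledAdj p H) where
  symm := by
    ext i j
    by_cases h : H.Adj i j
    · simp [scaledAdj, h, h.symm]
    · simp [scaledAdj, h, mt SimpleGraph.Adj.symm h]
  diag i := by simp [scaledAdj]
  nonneg i j := by
    simp only [scaledAdj, Matrix.of_apply]
    split_ifs <;> simp [hp0]
  le_one i j := by
    simp only [scaledAdj, Matrix.of_apply]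
    split_ifs <;> simp [hp1]

/-- The graph `H` has an edge, if there are at least two nodes, and the matrix with entry
`log² n / n` at its edges has row sums at most `D`. -/
def IsAdmissible {n : ℕ} (D : ℝ) (H : SimpleGraph (Fin n)) : Prop :=
  (∀ v, expectedDegree (scaledAdj (Real.log n ^ 2 / n) H) v ≤ D) ∧ (2 ≤ n → H ≠ ⊥)

lemma IsAdmissible.isGreatest {n : ℕ} {D : ℝ} {H : SimpleGraph (Fin n)} (h : IsAdmissible D H)
    (hn : 1 ≤ n) :
    IsGreatest (Set.range fun ij : Fin n × Fin n =>
      scaledAdj (Real.log n ^ 2 / n) H ij.1 ij.2) (Real.log n ^ 2 / n) := by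
  have hp : 0 ≤ Real.log n ^ 2 / (n : ℝ) := by positivity
  constructor
  · rcases hn.eq_or_lt with rfl | hn2
    -- For a single node the maximum is the diagonal entry `0 = log² 1 / 1`.
    · exact ⟨(0, 0), by simp [scaledAdj]⟩
    · obtain ⟨u, v, huv⟩ := SimpleGraph.ne_bot_iff_exists_adj.1 (h.2 hn2)
      exact ⟨(u, v), by simp [scaledAdj, huv]⟩
  · rintro _ ⟨⟨i, j⟩, rfl⟩
    simp only [scaledAdj, Matrix.of_apply]
    split_ifs
    · exact le_rfl
    · exact hp

/-- A single edge gives an admissible graph. -/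
lemma exists_isAdmissible {n : ℕ} {D : ℝ} (hn : 1 ≤ n) (hD : Real.log n ≤ D) :
    ∃ H : SimpleGraph (Fin n), IsAdmissible D H := by
  classical
  have hn0 : (0 : ℝ) < n := by exact_mod_cast hn
  have hL0 : 0 ≤ Real.log n := Real.log_natCast_nonneg n
  have hp : Real.log n ^ 2 / n ≤ D := by
    refine le_trans ?_ hD
    rw [div_le_iff₀ hn0, sq]
    exact mul_le_mul_of_nonneg_left (Real.log_le_self hn0.le) hL0
  rcases hn.eq_or_lt with rfl | hn2
  · exact ⟨⊥, fun v => by simpa [expectedDegree_scaledAdj] using hD, by omega⟩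
  · let a : Fin n := ⟨0, by omega⟩
    let b : Fin n := ⟨1, by omega⟩
    have hab : a ≠ b := by simp [a, b]
    refine ⟨SimpleGraph.fromEdgeSet {s(a, b)}, fun v => ?_, fun _ h => ?_⟩
    · rw [expectedDegree_scaledAdj]
      have hdeg : edgeDeg (SimpleGraph.fromEdgeSet {s(a, b)}) v ≤ 1 := by
        refine Finset.card_le_one.2 fun e he e' he' => Subtype.ext ?_
        simp only [Finset.mem_filter, SimpleGraph.edgeSet_fromEdgeSet, Set.mem_sdiff,
          Set.mem_singleton_iff] at he he'
        exact he.2.2.1.trans he'.2.2.1.symm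
      have hdeg' : (edgeDeg (SimpleGraph.fromEdgeSet {s(a, b)}) v : ℝ) ≤ 1 := by
        exact_mod_cast hdeg
      exact (mul_le_of_le_one_left (by positivity) hdeg').trans hp
    · have : (SimpleGraph.fromEdgeSet {s(a, b)}).Adj a b := by simp [hab]
      rw [h] at this
      exact this

/-- For every `n` there is an admissible graph, and for large `n` it is one whose random
subgraphs are rigid with high probability. -/
lemma exists_admissible_family {ε s : ℝ} (hε : 0 < ε) (hs0 : 0 < s) (hs1 : s ≤ 1) {d : ℕ → ℝ}
    (hd : ∀ n : ℕ, 1 ≤ n → (1 + ε) * Real.log n ≤ d n * s) :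
    ∃ H : (n : ℕ) → SimpleGraph (Fin n), (∀ n, 1 ≤ n → IsAdmissible (d n) (H n)) ∧
      ∃ u : ℕ → ℝ, Tendsto u atTop (𝓝 0) ∧
        ∀ᶠ n : ℕ in atTop, nonrigidProb (s * (Real.log n ^ 2 / n)) (H n) ≤ u n := by
  classical
  obtain ⟨u, hu, hev⟩ := exists_graph_of_large hε hs0 hs1
  have hlarge : ∀ᶠ n : ℕ in atTop, ∃ H : SimpleGraph (Fin n), IsAdmissible (d n) H ∧
      nonrigidProb (s * (Real.log n ^ 2 / n)) H ≤ u n := by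
    filter_upwards [hev, eventually_ge_atTop 2, hu.eventually_lt_const one_pos]
      with n ⟨H, hdeg, hH⟩ hn hu1
    have hn0 : (0 : ℝ) < n := by exact_mod_cast (by omega : 0 < n)
    have hL0 : 0 < Real.log n := Real.log_pos (by exact_mod_cast hn)
    refine ⟨H, ⟨fun v => ?_, fun _ h => ?_⟩, hH⟩
    · rw [expectedDegree_scaledAdj]
      calc _ ≤ (1 + ε) * n / (s * Real.log n) * (Real.log n ^ 2 / n) :=
            mul_le_mul_of_nonneg_right (hdeg v) (by positivity)
        _ = (1 + ε) * Real.log n / s := by field_simp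
        _ ≤ d n := by rw [div_le_iff₀ hs0]; exact hd n (by omega)
    · subst h
      have := one_le_nonrigidProb_bot hn (s * (Real.log n ^ 2 / n)) (by positivity)
        (mul_le_one₀ hs1 (by positivity) (log_sq_div_le_one n (by omega)))
      linarith
  have hall : ∀ n : ℕ, ∃ H : SimpleGraph (Fin n), (1 ≤ n → IsAdmissible (d n) H) ∧
      ((∃ H' : SimpleGraph (Fin n), IsAdmissible (d n) H' ∧
        nonrigidProb (s * (Real.log n ^ 2 / n)) H' ≤ u n) →
        nonrigidProb (s * (Real.log n ^ 2 / n)) H ≤ u n) := by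
    intro n
    by_cases hex : ∃ H' : SimpleGraph (Fin n), IsAdmissible (d n) H' ∧
        nonrigidProb (s * (Real.log n ^ 2 / n)) H' ≤ u n
    · obtain ⟨H, h1, h2⟩ := hex
      exact ⟨H, fun _ => h1, fun _ => h2⟩
    · by_cases hn : 1 ≤ n
      · have hL0 : 0 ≤ Real.log n := Real.log_natCast_nonneg n
        have hdn := hd n hn
        have hD : Real.log n ≤ d n := by
          have h0 : Real.log n ≤ d n * s := le_trans (by nlinarith) hdn
          have h1 : 0 ≤ d n := nonneg_of_mul_nonneg_left (hL0.trans h0) hs0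
          exact h0.trans (mul_le_of_le_one_right h1 hs1)
        obtain ⟨H, hH⟩ := exists_isAdmissible hn hD
        exact ⟨H, fun _ => hH, fun h => absurd h hex⟩
      · exact ⟨⊥, fun h => absurd h hn, fun h => absurd h hex⟩
  choose H hH1 hH2 using hall
  exact ⟨H, hH1, u, hu, hlarge.mono fun n hn => hH2 n hn⟩

theorem theorem2 (m : ℕ) [NeZero m] (ε s : ℝ) (hε : 0 < ε) (hs0 : 0 < s) (hs1 : s ≤ 1)
    (d : ℕ → ℝ) (hd : ∀ n : ℕ, 1 ≤ n → (1 + ε) * Real.log n ≤ d n * s) :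
    ∃ P : (n : ℕ) → Matrix (Fin n) (Fin n) ℝ,
      (∀ n : ℕ, 1 ≤ n →
        IsParameterMatrix (P n) ∧
        (∀ i, expectedDegree (P n) i ≤ d n) ∧
        IsGreatest (Set.range fun ij : Fin n × Fin n => P n ij.1 ij.2)
          (Real.log n ^ 2 / n)) ∧
      ∃ A : (n : ℕ) → Matrix (Fin n) (Fin n) ℝ → Estimator m n,
        Filter.Tendsto
          (fun n => exactMatchProb (P n) s (referenceLabelings m n) (A n (P n)))
          Filter.atTop (nhds 1) ∧
        Filter.Tendsto
          (fun n => exactMatchProb (P n) s Finset.univ (A n (P n)))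
          Filter.atTop (nhds 1) := by
  obtain ⟨H, hH, u, hu, hev⟩ := exists_admissible_family hε hs0 hs1 hd
  -- The alignment estimator treats all graphs alike, so the law of the relabelings is irrelevant.
  have hlim : ∀ L : (n : ℕ) → Finset (Labeling m n), (∀ n, (L n).Nonempty) →
      Tendsto (fun n : ℕ => exactMatchProb (scaledAdj (Real.log n ^ 2 / n) (H n)) s (L n)
        (alignEstimator m (supportGraph (scaledAdj (Real.log n ^ 2 / n) (H n)))))
        atTop (𝓝 1) := by
    intro L hL
    have hlow : Tendsto (fun n => 1 - m * u n) atTop (𝓝 1) := by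
      simpa using (hu.const_mul (m : ℝ)).const_sub 1
    refine tendsto_of_tendsto_of_tendsto_of_le_of_le' hlow tendsto_const_nhds ?_ ?_
    · filter_upwards [hev, eventually_ge_atTop 2] with n hn hn2
      have hn0 : (0 : ℝ) < n := by exact_mod_cast (by omega : 0 < n)
      have hL0 : 0 < Real.log n := Real.log_pos (by exact_mod_cast hn2)
      rw [supportGraph_scaledAdj (by positivity)]
      refine le_trans ?_ (le_exactMatchProb (by positivity) (log_sq_div_le_one n (by omega))
        hs0.le hs1 (H n) (hL n))
      gcongr
    · filter_upwards [eventually_ge_atTop 1] with n hn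
      exact exactMatchProb_le_one (by positivity) (log_sq_div_le_one n hn) hs0.le hs1 (H n) (hL n) _
  refine ⟨fun n => scaledAdj (Real.log n ^ 2 / n) (H n), fun n hn =>
    ⟨isParameterMatrix_scaledAdj (by positivity) (log_sq_div_le_one n hn) (H n), (hH n hn).1,
      (hH n hn).isGreatest hn⟩,
    fun n P => alignEstimator m (supportGraph P), ?_, ?_⟩
  · exact hlim (fun n => referenceLabelings m n) fun n => ⟨1, by simp [referenceLabelings]⟩
  · exact hlim (fun n => Finset.univ) fun n => Finset.univ_nonempty
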